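/- Let $d\ge 1$, $p\in[1,\infty)$, and let $\nu$ be a Borel measure on $\mathbb{R}^d$ with $\int_{\mathbb{R}^d}(1\wedge|y|^p)\,\nu(dy)<\infty$. For measurable $f:\mathbb{R}^d\to\mathbb{R}$ put $$\|f\|_{W^\nu_p}:=\|f\|_{L^p(\mathbb{R}^d)}+\Big(\int_{\mathbb{R}^d}\int_{\mathbb{R}^d}|f(x+h)-f(x)|^p\,dx\,\nu(dh)\Big)^{1/p},\qquad W^\nu_p:=\{f:\|f\|_{W^\nu_p}<\infty\},$$ and for $E\subset\mathbb{R}^d$ and $r>0$ let $$\mathrm{Cap}_{\nu,p}(E):=\inf\{\|f\|_{W^\nu_p}^p: f\in W^\nu_p,\ E\subset\operatorname{int}\{f\ge 1\}\},\qquad h_p(r):=\int_{\mathbb{R}^d}\Big(1\wedge\frac{|y|^p}{r^p}\Big)\,\nu(dy).$$ Assume that $\nu(dy)=\varphi(|y|)\,dy$ for a measurable $\varphi:(0,\infty)\to[0,\infty)$ whose lower Matuszewska index at zero is strictly bigger than $-d-1$; here this index is the supremum in $[-\infty,\infty]$ of all $a\in\mathbb{R}$ for which there are $A,R_0>0$ such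 that $\varphi$ is positive on $(0,R_0)$ and $\varphi(r_2)/\varphi(r_1)\ge A\,(r_2/r_1)^a$ whenever $0<r_1<r_2<R_0$. Then there are constants $c,C>0$ such that for all $x\in\mathbb{R}^d$ and $r>0$ $$c\,r^d\,(1+h_p(r))\ \le\ \mathrm{Cap}_{\nu,p}(B(x,r))\ \le\ C\,r^d\,(1+h_p(r)),$$ where $B(x,r)$ is the open ball with center $x$ and radius $r$. (The constants do not depend on $x$ and $r$.) -/

import Mathlib

open MeasureTheory
open scoped ENNReal

/-- The Euclidean space `ℝ^d`. -/
abbrev Rd (d : ℕ) : Type := EuclideanSpace ℝ (Fin d)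

/-- The nonlocal seminorm
`[f] = (∫ ∫ |f (x + h) - f x| ^ p dx ν(dh)) ^ (1 / p)`, with values in `[0, ∞]`. -/
noncomputable def nonlocalSeminorm {d : ℕ} (ν : Measure (Rd d)) (p : ℝ) (f : Rd d → ℝ) : ℝ≥0∞ :=
  (∫⁻ h, (∫⁻ x, ‖f (x + h) - f x‖ₑ ^ p) ∂ν) ^ (1 / p)

/-- The nonlocal Sobolev norm `‖f‖ = ‖f‖_p + [f]`, with values in `[0, ∞]`. -/
noncomputable def nonlocalNorm {d : ℕ} (ν : Measure (Rd d)) (p : ℝ) (f : Rd d → ℝ) : ℝ≥0∞ :=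
  eLpNorm f (ENNReal.ofReal p) volume + nonlocalSeminorm ν p f

/-- The nonlocal Sobolev space: Lebesgue measurable functions with finite nonlocal Sobolev norm. -/
def nonlocalSobolev {d : ℕ} (ν : Measure (Rd d)) (p : ℝ) : Set (Rd d → ℝ) :=
  {f | AEStronglyMeasurable f volume ∧ nonlocalNorm ν p f < ∞}

/-- The nonlocal capacity of an arbitrary set `E`: the infimum of `‖f‖ ^ p` over all `f` in the
nonlocal Sobolev space such that `E` lies in the interior of `{f ≥ 1}`. -/
noncomputable def nonlocalCap {d : ℕ} (ν : Measure (Rd d)) (p : ℝ) (E : Set (Rd d)) : ℝ≥0∞ :=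
  sInf {t | ∃ f ∈ nonlocalSobolev ν p, E ⊆ interior {x | 1 ≤ f x} ∧ t = nonlocalNorm ν p f ^ p}

/-- The concentration function `h_p(r) = ∫ (1 ∧ |y| ^ p / r ^ p) ν(dy)`. -/
noncomputable def concentration {d : ℕ} (ν : Measure (Rd d)) (p r : ℝ) : ℝ≥0∞ :=
  ∫⁻ y, ENNReal.ofReal (min 1 (‖y‖ ^ p / r ^ p)) ∂ν

/-- The lower Matuszewska index at zero of a function `φ` on `(0, ∞)`: the supremum in `[-∞, ∞]`
of all real `a` such that `φ r₂ / φ r₁ ≥ A (r₂ / r₁) ^ a` whenever `0 < r₁ < r₂ < R₀`, for some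
constants `A, R₀ > 0`. For `φ ≥ 0` the inequality forces `φ > 0` on `(0, R₀)`, because a quotient
with zero denominator is zero. -/
noncomputable def lowerMatuszewskaIndexAtZero (φ : ℝ → ℝ) : EReal :=
  sSup {α : EReal | ∃ a : ℝ, α = (a : EReal) ∧
    ∃ A : ℝ, 0 < A ∧ ∃ R₀ : ℝ, 0 < R₀ ∧
      ∀ r₁ r₂ : ℝ, 0 < r₁ → r₁ < r₂ → r₂ < R₀ → A * (r₂ / r₁) ^ a ≤ φ r₂ / φ r₁}

/-! The upper bound comes from testing with a Lipschitz cutoff of height 1 at scale `r`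
(`nonlocalCap_ball_le`). For the lower bound, the index hypothesis gives a scaling exponent `a > -d
- 1`, so some `q` in `(0, 1)` has `q + a > -d`. Then `h_q` is finite, it dominates `h_p` because `q
< p`, and it grows at most like `λ ^ q` when the radius shrinks by `λ`, with `q < d`. The core is an
isoperimetric estimate (`exists_concentration_le_mul_one_add_measure_compl`): a set filling at most
half of the volume of a ball of radius `r` leaves outside a `ν`-mass that controls `h_q(r)` up to
constants. It is applied to translated superlevel sets `{f ≥ s ^ k}`. By Chebyshev their volumes
cannot grow by the factor `2 ^ d` at every step, so at some `k` the growth fails. There the set `{f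
≥ s ^ k}` is large, while `{f ≥ s ^ (k + 1)}` is too small to absorb the jumps started in it. These
jumps cost a fixed fraction of `s ^ k`, which bounds the seminorm below
(`exists_volume_ball_mul_le_nonlocalNorm_rpow`). Since `q < d`, the loss in passing to the larger
radius is compensated by the volume gained. -/

/-- A real function on `(0, R)` whose quotients are bounded below by a power. -/
def LowerScaling (φ : ℝ → ℝ) (A R a : ℝ) : Prop :=
  ∀ r₁ r₂ : ℝ, 0 < r₁ → r₁ < r₂ → r₂ < R → φ r₁ ≤ A⁻¹ * (r₁ / r₂) ^ a * φ r₂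

theorem exists_lowerScaling {φ : ℝ → ℝ} (hφ : ∀ r : ℝ, 0 < r → 0 ≤ φ r) {b : ℝ}
    (h : (b : EReal) < lowerMatuszewskaIndexAtZero φ) :
    ∃ a A R : ℝ, b < a ∧ 0 < A ∧ 0 < R ∧ LowerScaling φ A R a := by
  obtain ⟨α, ⟨a, rfl, A, hA, R, hR, H⟩, hba⟩ := lt_sSup_iff.1 h
  refine ⟨a, A, R, by exact_mod_cast hba, hA, hR, fun r₁ r₂ h₁ h₁₂ h₂ => ?_⟩
  have h₂' : 0 < r₂ := h₁.trans h₁₂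
  have key := H r₁ r₂ h₁ h₁₂ h₂
  have hpos : 0 < A * (r₂ / r₁) ^ a := by positivity
  -- If `φ r₁` vanished, the quotient would be zero by convention, against its positive lower bound.
  have hφ₁ : 0 < φ r₁ := by
    refine lt_of_le_of_ne (hφ r₁ h₁) fun h0 => ?_
    rw [← h0, div_zero] at key
    linarith
  rw [le_div_iff₀ hφ₁] at key
  have e : (r₁ / r₂) ^ a * (r₂ / r₁) ^ a = 1 := by
    rw [← Real.mul_rpow (by positivity) (by positivity)]
    rw [div_mul_div_cancel₀ h₂'.ne', div_self h₁.ne', Real.one_rpow]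
  calc φ r₁ = (A⁻¹ * A) * ((r₁ / r₂) ^ a * (r₂ / r₁) ^ a) * φ r₁ := by
        rw [e, inv_mul_cancel₀ hA.ne']; ring
    _ = A⁻¹ * (r₁ / r₂) ^ a * (A * (r₂ / r₁) ^ a * φ r₁) := by ring
    _ ≤ _ := by gcongr

theorem rpow_le_two_rpow_abs {t a : ℝ} (h : 1 / 2 ≤ t) (h1 : t ≤ 1) : t ^ a ≤ 2 ^ |a| := by
  have ht : 0 < t := by linarith
  rcases le_total 0 a with ha | ha
  · exact (Real.rpow_le_one ht.le h1 ha).trans (Real.one_le_rpow one_le_two (abs_nonneg a))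
  · rw [abs_of_nonpos ha, Real.rpow_neg zero_le_two, ← Real.inv_rpow zero_le_two]
    exact Real.rpow_le_rpow_of_nonpos (by norm_num) (by simpa using h) ha

/-! ### Volumes of balls and shells, and power integrals -/

theorem volume_ball_Rd {d : ℕ} (x : Rd d) {r : ℝ} (hr : 0 < r) :
    volume (Metric.ball x r) = ENNReal.ofReal (r ^ d) * volume (Metric.ball (0 : Rd d) 1) := by
  simpa using Measure.addHaar_ball_of_pos (volume : Measure (Rd d)) x hr

theorem volume_ball_two_mul {d : ℕ} (x : Rd d) {r : ℝ} (hr : 0 < r) :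
    volume (Metric.ball x (2 * r)) = 2 ^ d * volume (Metric.ball x r) := by
  rw [volume_ball_Rd x hr, volume_ball_Rd x (by positivity), mul_pow,
    ENNReal.ofReal_mul (by positivity), ENNReal.ofReal_pow zero_le_two, ENNReal.ofReal_ofNat,
    mul_assoc]

/-- The shell has volume `(2 ^ d - 1) |B_r| ≥ |B_r|` because `d ≥ 1`, and removing `E` costs at most
half of `|B_r|`. This leaves room to average over points outside `E`. -/
theorem half_volume_ball_le_volume_shell_diff {d : ℕ} (hd : 1 ≤ d) {r : ℝ} (hr : 0 < r)
    {E : Set (Rd d)} (hE : volume E ≤ volume (Metric.ball (0 : Rd d) r) / 2) :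
    volume (Metric.ball (0 : Rd d) r) / 2 ≤
      volume ((Metric.ball (0 : Rd d) (2 * r) \ Metric.closedBall 0 r) \ E) := by
  set V := volume (Metric.ball (0 : Rd d) r) with hV
  set S := (Metric.ball (0 : Rd d) (2 * r) \ Metric.closedBall 0 r) \ E
  have hVt : V ≠ ∞ := measure_ball_lt_top.ne
  have h1 : 2 * V ≤ volume (Metric.ball (0 : Rd d) (2 * r)) := by
    rw [volume_ball_two_mul _ hr]
    gcongr
    calc (2 : ℝ≥0∞) = 2 ^ 1 := (pow_one _).symm
      _ ≤ 2 ^ d := pow_le_pow_right₀ one_le_two hd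
  have hsub : Metric.ball (0 : Rd d) (2 * r) ⊆ Metric.closedBall 0 r ∪ (E ∪ S) := by
    intro y hy
    by_cases h : y ∈ Metric.closedBall (0 : Rd d) r
    · exact Or.inl h
    · by_cases h' : y ∈ E
      · exact Or.inr (Or.inl h')
      · exact Or.inr (Or.inr ⟨⟨hy, h⟩, h'⟩)
  have hc : volume (Metric.closedBall (0 : Rd d) r) = V := by
    rw [hV, volume_ball_Rd _ hr]
    simpa using Measure.addHaar_closedBall (volume : Measure (Rd d)) 0 hr.le
  have h2 : 2 * V ≤ V + (V / 2 + volume S) := by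
    calc 2 * V ≤ _ := h1
      _ ≤ volume (Metric.closedBall (0 : Rd d) r ∪ (E ∪ S)) := measure_mono hsub
      _ ≤ volume (Metric.closedBall (0 : Rd d) r) + (volume E + volume S) :=
        (measure_union_le _ _).trans (by gcongr; exact measure_union_le _ _)
      _ ≤ _ := by rw [hc]; gcongr
  rw [two_mul, ENNReal.add_le_add_iff_left hVt] at h2
  nth_rewrite 1 [← ENNReal.add_halves V] at h2
  rwa [ENNReal.add_le_add_iff_left (by finiteness)] at h2

theorem lintegral_ball_norm_rpow_lt_top {d : ℕ} (hd : 1 ≤ d) {b : ℝ} (hb : -(d : ℝ) < b) :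
    ∫⁻ z in Metric.ball (0 : Rd d) 1, ENNReal.ofReal (‖z‖ ^ b) < ∞ := by
  have : Nonempty (Fin d) := ⟨⟨0, hd⟩⟩
  have : IntegrableOn (fun z : Rd d => ‖z‖ ^ b) (Metric.ball 0 1) := by
    rw [integrableOn_fun_norm_addHaar (volume : Measure (Rd d)) (f := fun t : ℝ => t ^ b)]
    have h : IntegrableOn (fun t : ℝ => t ^ ((d : ℝ) - 1 + b)) (Set.Ioo 0 1) := by
      rw [intervalIntegral.integrableOn_Ioo_rpow_iff one_pos]
      linarith
    refine h.congr_fun (fun t ht => ?_) measurableSet_Ioo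
    have e : ((d - 1 : ℕ) : ℝ) = (d : ℝ) - 1 := by push_cast [Nat.cast_sub hd]; ring
    simp only [finrank_euclideanSpace_fin, smul_eq_mul]
    rw [Real.rpow_add ht.1, ← e, Real.rpow_natCast]
  exact this.lintegral_lt_top

theorem lintegral_ball_norm_div_rpow {d : ℕ} {b r : ℝ} (hr : 0 < r) :
    ∫⁻ z in Metric.ball (0 : Rd d) r, ENNReal.ofReal ((‖z‖ / r) ^ b) =
      ENNReal.ofReal (r ^ d) * ∫⁻ z in Metric.ball (0 : Rd d) 1, ENNReal.ofReal (‖z‖ ^ b) := by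
  have hm : Measurable fun z : Rd d => ENNReal.ofReal ((‖z‖ / r) ^ b) := by fun_prop
  have h := setLIntegral_map (μ := (volume : Measure (Rd d)))
    (measurableSet_ball (x := (0 : Rd d)) (ε := r)) hm (measurable_const_smul r)
  rw [Measure.map_addHaar_smul _ hr.ne', Measure.restrict_smul, lintegral_smul_measure] at h
  have hs : (fun z : Rd d => r • z) ⁻¹' Metric.ball 0 r = Metric.ball 0 1 := by
    ext z
    simp [norm_smul, abs_of_pos hr, hr]
  rw [hs] at h
  have hz : ∀ z : Rd d, ‖r • z‖ / r = ‖z‖ := fun z => by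
    rw [norm_smul, Real.norm_of_nonneg hr.le, mul_div_cancel_left₀ _ hr.ne']
  simp only [hz] at h
  rw [← h, smul_eq_mul, ← mul_assoc, ← ENNReal.ofReal_mul (by positivity),
    finrank_euclideanSpace_fin,
    abs_of_pos (by positivity), mul_inv_cancel₀ (by positivity), ENNReal.ofReal_one, one_mul]

/-! ### Integral consequences of lower scaling -/

section LowerScaling

variable {d : ℕ} {φ : ℝ → ℝ} {A R a q : ℝ}

/-- Scaling compares `φ ‖z‖` with `φ ‖y‖` at the cost of `(‖z‖ / r) ^ a`, leaving a power integral
of exponent `q + a`. As `y` is arbitrary in the shell, the bound can later be averaged over `y`. -/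
theorem setLIntegral_ball_le_of_lowerScaling (hφ : ∀ r : ℝ, 0 < r → 0 ≤ φ r) (hA : 0 < A)
    (hs : LowerScaling φ A R a) (hq : 0 < q) {r : ℝ} (hr : 0 < r) (hrR : 2 * r ≤ R)
    {y : Rd d} (h1 : r < ‖y‖) (h2 : ‖y‖ < 2 * r) :
    ∫⁻ z in Metric.ball (0 : Rd d) r, ENNReal.ofReal ((‖z‖ / r) ^ q) * ENNReal.ofReal (φ ‖z‖) ≤
      ENNReal.ofReal (A⁻¹ * 2 ^ |a|) * (ENNReal.ofReal (r ^ d) *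
        ∫⁻ z in Metric.ball (0 : Rd d) 1, ENNReal.ofReal (‖z‖ ^ (q + a))) *
        ENNReal.ofReal (φ ‖y‖) := by
  have hy : 0 < ‖y‖ := hr.trans h1
  rw [← lintegral_ball_norm_div_rpow hr, ← lintegral_const_mul' _ _ ENNReal.ofReal_ne_top,
    ← lintegral_mul_const' _ _ ENNReal.ofReal_ne_top]
  refine setLIntegral_mono (by fun_prop) fun z hz => ?_
  have hz' : ‖z‖ < r := by simpa using hz
  rcases (norm_nonneg z).eq_or_lt with h0 | h0
  -- Scaling says nothing at the origin; there the weight vanishes because `q ≠ 0`.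
  · simp [← h0, Real.zero_rpow hq.ne']
  rw [← ENNReal.ofReal_mul (by positivity), ← ENNReal.ofReal_mul (by positivity),
    ← ENNReal.ofReal_mul (by positivity)]
  apply ENNReal.ofReal_le_ofReal
  have e : ‖z‖ / ‖y‖ = ‖z‖ / r * (r / ‖y‖) := by field_simp
  have h3 : (r / ‖y‖) ^ a ≤ 2 ^ |a| :=
    rpow_le_two_rpow_abs (by rw [div_le_div_iff₀ two_pos hy]; linarith)
      (by rw [div_le_one hy]; exact h1.le)
  have h4 := hs ‖z‖ ‖y‖ h0 (hz'.trans h1) (h2.trans_le hrR)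
  rw [e, Real.mul_rpow (by positivity) (by positivity)] at h4
  have hφy := hφ _ hy
  calc (‖z‖ / r) ^ q * φ ‖z‖
      ≤ (‖z‖ / r) ^ q * (A⁻¹ * ((‖z‖ / r) ^ a * 2 ^ |a|) * φ ‖y‖) := by
        gcongr
        exact h4.trans (by gcongr)
    _ = A⁻¹ * 2 ^ |a| * (‖z‖ / r) ^ (q + a) * φ ‖y‖ := by
        rw [Real.rpow_add (by positivity)]; ring

/-- By Tonelli, each `y` is counted by the `z` in a ball of radius `‖y‖`, whose volume is `2 ^ d`
times the normalising one. -/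
theorem lintegral_norm_lt_swap {g : Rd d → ℝ≥0∞} (hg : Measurable g) :
    ∫⁻ z : Rd d, ∫⁻ y in {y : Rd d | ‖z‖ < ‖y‖}, g y * (volume (Metric.ball (0 : Rd d) (‖y‖ / 2)))⁻¹
      ≤ 2 ^ d * ∫⁻ y, g y := by
  have hV : Measurable fun y : Rd d => (volume (Metric.ball (0 : Rd d) (‖y‖ / 2))) := by
    have hmono : Monotone fun t : ℝ => volume (Metric.ball (0 : Rd d) (t / 2)) :=
      fun s t hst => measure_mono (Metric.ball_subset_ball (by linarith))
    exact hmono.measurable.comp measurable_norm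
  have hF : Measurable (Function.uncurry fun z y : Rd d =>
      {y : Rd d | ‖z‖ < ‖y‖}.indicator
        (fun y => g y * (volume (Metric.ball (0 : Rd d) (‖y‖ / 2)))⁻¹) y) := by
    have hS : MeasurableSet {w : Rd d × Rd d | ‖w.1‖ < ‖w.2‖} :=
      measurableSet_lt (by fun_prop) (by fun_prop)
    have hk : Measurable fun w : Rd d × Rd d =>
        g w.2 * (volume (Metric.ball (0 : Rd d) (‖w.2‖ / 2)))⁻¹ :=
      (hg.mul hV.inv).comp measurable_snd
    exact hk.indicator hS
  have hm : ∀ z : Rd d, MeasurableSet {y : Rd d | ‖z‖ < ‖y‖} := fun z =>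
    measurableSet_lt (by fun_prop) (by fun_prop)
  simp_rw [← lintegral_indicator (hm _)]
  rw [lintegral_lintegral_swap hF.aemeasurable, ← lintegral_const_mul _ hg]
  refine lintegral_mono fun y => ?_
  have e : ∀ z : Rd d, {y : Rd d | ‖z‖ < ‖y‖}.indicator
        (fun y => g y * (volume (Metric.ball (0 : Rd d) (‖y‖ / 2)))⁻¹) y =
      (Metric.ball (0 : Rd d) ‖y‖).indicator
        (fun _ => g y * (volume (Metric.ball (0 : Rd d) (‖y‖ / 2)))⁻¹) z := fun z => by
    simp [Set.indicator]
  simp_rw [e]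
  rw [lintegral_indicator measurableSet_ball, setLIntegral_const]
  rcases (norm_nonneg y).eq_or_lt with h0 | h0
  · simp [← h0]
  have hb : volume (Metric.ball (0 : Rd d) (‖y‖ / 2)) ≠ 0 :=
    (Metric.measure_ball_pos _ _ (by positivity)).ne'
  have h2 := volume_ball_two_mul (0 : Rd d) (half_pos h0)
  rw [mul_div_cancel₀ _ two_ne_zero] at h2
  rw [h2, mul_assoc, mul_comm (2 ^ d), ← mul_assoc _ _ (2 ^ d),
    ENNReal.inv_mul_cancel hb measure_ball_lt_top.ne, one_mul, mul_comm]

/-- Each `φ ‖z‖` is bounded by an average of `φ ‖y‖` over the part of the shell `‖z‖ < ‖y‖ < 2‖z‖`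
outside `E`. The weight `1 / |B_‖z‖|` is enlarged to one depending only on `y`, so that integrating
in `z` reduces to `lintegral_norm_lt_swap`. -/
theorem setLIntegral_shell_le_of_lowerScaling (hd : 1 ≤ d) (hφm : Measurable φ)
    (hφ : ∀ r : ℝ, 0 < r → 0 ≤ φ r) (hA : 0 < A)
    (hs : LowerScaling φ A R a) {r : ℝ} (hr : 0 < r) {E : Set (Rd d)} (hEm : MeasurableSet E)
    (hE : volume E ≤ volume (Metric.ball (0 : Rd d) r) / 2) :
    ∫⁻ z in Metric.ball (0 : Rd d) (R / 2) \ Metric.ball 0 r, ENNReal.ofReal (φ ‖z‖) ≤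
      ENNReal.ofReal (A⁻¹ * 2 ^ |a|) * 2 * 2 ^ d * ∫⁻ y in Eᶜ, ENNReal.ofReal (φ ‖y‖) := by
  set K := ENNReal.ofReal (A⁻¹ * 2 ^ |a|)
  set g : Rd d → ℝ≥0∞ := fun y => ENNReal.ofReal (φ ‖y‖)
  have hgm : Measurable g := by fun_prop
  have hgm' : Measurable (Eᶜ.indicator g) := hgm.indicator hEm.compl
  have key : ∀ z ∈ Metric.ball (0 : Rd d) (R / 2) \ Metric.ball 0 r, g z ≤
      K * 2 * ∫⁻ y in {y : Rd d | ‖z‖ < ‖y‖}, Eᶜ.indicator g y *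
        (volume (Metric.ball (0 : Rd d) (‖y‖ / 2)))⁻¹ := by
    rintro z ⟨hz1, hz2⟩
    replace hz1 : ‖z‖ < R / 2 := by simpa using hz1
    replace hz2 : r ≤ ‖z‖ := by simpa using hz2
    have hz : 0 < ‖z‖ := hr.trans_le hz2
    set V := volume (Metric.ball (0 : Rd d) ‖z‖) 
    have hV0 : V ≠ 0 := (Metric.measure_ball_pos _ _ hz).ne'
    have hVt : V ≠ ∞ := measure_ball_lt_top.ne
    set S := (Metric.ball (0 : Rd d) (2 * ‖z‖) \ Metric.closedBall 0 ‖z‖) \ E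
    have hSm : MeasurableSet S := (measurableSet_ball.diff measurableSet_closedBall).diff hEm
    have hSV : V / 2 ≤ volume S := half_volume_ball_le_volume_shell_diff hd hz
      (hE.trans (by gcongr))
    have h1 : g z * volume S * V⁻¹ ≤ K * ∫⁻ y in {y : Rd d | ‖z‖ < ‖y‖}, Eᶜ.indicator g y *
        (volume (Metric.ball (0 : Rd d) (‖y‖ / 2)))⁻¹ := by
      rw [mul_right_comm, ← setLIntegral_const, ← lintegral_const_mul' _ _ ENNReal.ofReal_ne_top]
      have hsub : S ⊆ {y : Rd d | ‖z‖ < ‖y‖} := fun y hy => by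
        have := hy.1.2
        simpa using this
      refine le_trans ?_ (lintegral_mono_set hsub)
      refine setLIntegral_mono' hSm fun y hy => ?_
      have hy1 : ‖z‖ < ‖y‖ := hsub hy
      have hy2 : ‖y‖ < 2 * ‖z‖ := by simpa using hy.1.1
      have hy0 : 0 < ‖y‖ := hz.trans hy1
      rw [Set.indicator_of_mem (show y ∈ Eᶜ from hy.2), ← mul_assoc]
      refine mul_le_mul' ?_ ?_
      · change ENNReal.ofReal (φ ‖z‖) ≤ ENNReal.ofReal _ * ENNReal.ofReal (φ ‖y‖)
        rw [← ENNReal.ofReal_mul (by positivity)]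
        apply ENNReal.ofReal_le_ofReal
        have := hφ _ hy0
        refine (hs ‖z‖ ‖y‖ hz hy1 (by linarith)).trans ?_
        gcongr
        exact rpow_le_two_rpow_abs (by rw [div_le_div_iff₀ two_pos hy0]; linarith)
          (by rw [div_le_one hy0]; exact hy1.le)
      · rw [ENNReal.inv_le_inv]
        exact measure_mono (Metric.ball_subset_ball (by linarith))
    calc g z = g z * (V / 2) * V⁻¹ * 2 := by
          calc g z = g z * ((2⁻¹ * 2) * (V * V⁻¹)) := by
                rw [ENNReal.inv_mul_cancel two_ne_zero (by finiteness),
                  ENNReal.mul_inv_cancel hV0 hVt, one_mul, mul_one]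
            _ = _ := by rw [ENNReal.div_eq_inv_mul]; ring
      _ ≤ g z * volume S * V⁻¹ * 2 := by gcongr
      _ ≤ _ := by rw [mul_right_comm K]; gcongr
  calc ∫⁻ z in Metric.ball (0 : Rd d) (R / 2) \ Metric.ball 0 r, g z
      ≤ ∫⁻ z in Metric.ball (0 : Rd d) (R / 2) \ Metric.ball 0 r,
          K * 2 * ∫⁻ y in {y : Rd d | ‖z‖ < ‖y‖}, Eᶜ.indicator g y *
            (volume (Metric.ball (0 : Rd d) (‖y‖ / 2)))⁻¹ :=
        setLIntegral_mono' (measurableSet_ball.diff measurableSet_ball) key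
    _ ≤ ∫⁻ z : Rd d, K * 2 * ∫⁻ y in {y : Rd d | ‖z‖ < ‖y‖}, Eᶜ.indicator g y *
            (volume (Metric.ball (0 : Rd d) (‖y‖ / 2)))⁻¹ := setLIntegral_le_lintegral _ _
    _ = K * 2 * ∫⁻ z : Rd d, ∫⁻ y in {y : Rd d | ‖z‖ < ‖y‖}, Eᶜ.indicator g y *
            (volume (Metric.ball (0 : Rd d) (‖y‖ / 2)))⁻¹ :=
        lintegral_const_mul' _ _ (by finiteness)
    _ ≤ K * 2 * (2 ^ d * ∫⁻ y, Eᶜ.indicator g y) := by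
        gcongr
        exact lintegral_norm_lt_swap hgm'
    _ = _ := by rw [lintegral_indicator hEm.compl, mul_assoc (K * 2)]

end LowerScaling

/-! ### Monotonicity and splitting of the concentration function -/

section Concentration

variable {d : ℕ} {ν : Measure (Rd d)}

theorem concentration_anti_exponent {p q : ℝ} (hqp : q ≤ p) (hq : 0 < q) {r : ℝ} (hr : 0 < r) :
    concentration ν p r ≤ concentration ν q r := by
  refine lintegral_mono fun y => ENNReal.ofReal_le_ofReal ?_
  rw [← Real.div_rpow (norm_nonneg y) hr.le, ← Real.div_rpow (norm_nonneg y) hr.le]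
  have ht : 0 ≤ ‖y‖ / r := by positivity
  rcases le_total (‖y‖ / r) 1 with h | h
  · exact min_le_min_left 1
      (Real.rpow_le_rpow_of_exponent_ge_of_imp ht h hqp fun _ h0 =>
        absurd h0 (hq.trans_le hqp).ne')
  · exact (min_le_left _ _).trans (le_min le_rfl (Real.one_le_rpow h hq.le))

theorem concentration_anti {q : ℝ} (hq : 0 < q) {r s : ℝ} (hr : 0 < r) (hrs : r ≤ s) :
    concentration ν q s ≤ concentration ν q r :=
  lintegral_mono fun y => ENNReal.ofReal_le_ofReal (by gcongr)

/-- The integrand obeys this bound pointwise, since `s / r ≥ 1`. The exponent `q`, later less than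
`d`, is what volume growth has to beat. -/
theorem concentration_le_mul {q : ℝ} (hq : 0 < q) {r s : ℝ} (hr : 0 < r) (hrs : r ≤ s) :
    concentration ν q r ≤ ENNReal.ofReal ((s / r) ^ q) * concentration ν q s := by
  rw [concentration, concentration, ← lintegral_const_mul' _ _ ENNReal.ofReal_ne_top]
  have hs : 0 < s := hr.trans_le hrs
  refine lintegral_mono fun y => ?_
  rw [← ENNReal.ofReal_mul (by positivity)]
  apply ENNReal.ofReal_le_ofReal
  have h1 : 1 ≤ (s / r) ^ q := Real.one_le_rpow ((one_le_div hr).2 hrs) hq.le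
  rw [mul_min_of_nonneg _ _ (by positivity), mul_one, Real.div_rpow hs.le hr.le]
  rw [Real.div_rpow hs.le hr.le] at h1
  refine min_le_min h1 (le_of_eq ?_)
  have := Real.rpow_pos_of_pos hs q
  field_simp

theorem measure_compl_ball_lt_top {p : ℝ} (hp : 0 < p)
    (hν : ∫⁻ y, ENNReal.ofReal (min 1 (‖y‖ ^ p)) ∂ν < ∞) {s : ℝ} (hs : 0 < s) :
    ν (Metric.ball 0 s)ᶜ < ∞ := by
  set m := ENNReal.ofReal (min 1 (s ^ p)) with hm
  have hm0 : m ≠ 0 := by simpa [hm] using Real.rpow_pos_of_pos hs p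
  have hsub : (Metric.ball (0 : Rd d) s)ᶜ ⊆
      {y | m ≤ ENNReal.ofReal (min 1 (‖y‖ ^ p))} := fun y hy => by
    have hy' : s ≤ ‖y‖ := by simpa using hy
    exact ENNReal.ofReal_le_ofReal (by gcongr)
  refine (measure_mono hsub).trans_lt ?_
  have hmeas : Measurable fun y : Rd d => ENNReal.ofReal (min 1 (‖y‖ ^ p)) := by fun_prop
  exact (meas_ge_le_lintegral_div hmeas.aemeasurable hm0 ENNReal.ofReal_ne_top).trans_lt
    (ENNReal.div_lt_top hν.ne hm0)

theorem concentration_withDensity_le {g : Rd d → ℝ≥0∞} (hg : Measurable g) {q r R : ℝ}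
    (hr : 0 < r) :
    concentration (volume.withDensity g) q r ≤
      (∫⁻ z in Metric.ball (0 : Rd d) r, ENNReal.ofReal ((‖z‖ / r) ^ q) * g z) +
      (∫⁻ z in Metric.ball (0 : Rd d) R \ Metric.ball 0 r, g z) +
      volume.withDensity g (Metric.ball 0 R)ᶜ := by
  have hk : Measurable fun z : Rd d => ENNReal.ofReal ((‖z‖ / r) ^ q) * g z := by fun_prop
  rw [concentration, lintegral_withDensity_eq_lintegral_mul _ hg (by fun_prop),
    withDensity_apply _ measurableSet_ball.compl, ← lintegral_indicator measurableSet_ball,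
    ← lintegral_indicator (measurableSet_ball.diff measurableSet_ball),
    ← lintegral_indicator measurableSet_ball.compl,
    ← lintegral_add_left (hk.indicator measurableSet_ball),
    ← lintegral_add_right _ (hg.indicator measurableSet_ball.compl)]
  refine lintegral_mono fun z => ?_
  simp only [Pi.mul_apply]
  have h1 : g z * ENNReal.ofReal (min 1 (‖z‖ ^ q / r ^ q)) ≤ g z := by
    refine mul_le_of_le_one_right' ?_
    simp
  by_cases hz : z ∈ Metric.ball (0 : Rd d) r
  · rw [Set.indicator_of_mem hz, mul_comm]
    refine le_add_right (le_add_right ?_)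
    gcongr
    rw [Real.div_rpow (norm_nonneg z) hr.le]
    exact min_le_right _ _
  by_cases hz' : z ∈ Metric.ball (0 : Rd d) R
  · rw [Set.indicator_of_mem (s := Metric.ball (0 : Rd d) R \ _) ⟨hz', hz⟩]
    exact le_add_right (le_add_left h1)
  · rw [Set.indicator_of_mem (s := (Metric.ball (0 : Rd d) R)ᶜ) hz']
    exact le_add_left h1

end Concentration

/-! ### Isoperimetric inequality -/

/-- A nonlocal isoperimetric inequality: the `ν`-mass of the complement of a set of small volume
controls the concentration function. -/
theorem exists_concentration_le_mul_one_add_measure_compl {d : ℕ} (hd : 1 ≤ d) {φ : ℝ → ℝ}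
    {A R a p q : ℝ} (hφm : Measurable φ) (hφ : ∀ r : ℝ, 0 < r → 0 ≤ φ r) (hA : 0 < A) (hR : 0 < R)
    (hs : LowerScaling φ A R a) (hp : 0 < p) (hq : 0 < q) (hqa : -(d : ℝ) < q + a)
    {ν : Measure (Rd d)} (hν : ν = volume.withDensity fun y => ENNReal.ofReal (φ ‖y‖))
    (hνp : ∫⁻ y, ENNReal.ofReal (min 1 (‖y‖ ^ p)) ∂ν < ∞) :
    ∃ C : ℝ≥0∞, C ≠ ∞ ∧ ∀ r : ℝ, 0 < r → ∀ E : Set (Rd d), MeasurableSet E →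
      volume E ≤ volume (Metric.ball (0 : Rd d) r) / 2 →
      concentration ν q r ≤ C * (1 + ν Eᶜ) := by
  set g : Rd d → ℝ≥0∞ := fun y => ENNReal.ofReal (φ ‖y‖)
  have hgm : Measurable g := by fun_prop
  set K := ENNReal.ofReal (A⁻¹ * 2 ^ |a|)
  set J := ∫⁻ z in Metric.ball (0 : Rd d) 1, ENNReal.ofReal (‖z‖ ^ (q + a))
  have hJ : J < ∞ := lintegral_ball_norm_rpow_lt_top hd hqa
  set ω := volume (Metric.ball (0 : Rd d) 1) with hω
  have hω0 : ω ≠ 0 := (Metric.measure_ball_pos _ _ one_pos).ne'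
  have hωt : ω ≠ ∞ := measure_ball_lt_top.ne
  set T := ν (Metric.ball 0 (R / 2))ᶜ
  have hT : T < ∞ := measure_compl_ball_lt_top hp hνp (by positivity)
  have near : ∀ r : ℝ, 0 < r → r ≤ R / 4 → ∀ y : Rd d, r < ‖y‖ → ‖y‖ < 2 * r →
      ∫⁻ z in Metric.ball (0 : Rd d) r, ENNReal.ofReal ((‖z‖ / r) ^ q) * g z ≤
        K * (ENNReal.ofReal (r ^ d) * J) * g y := fun r hr hrR y h1 h2 =>
    setLIntegral_ball_le_of_lowerScaling hφ hA hs hq hr (by linarith) h1 h2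
  have small : ∀ r : ℝ, 0 < r → r ≤ R / 4 → ∀ E : Set (Rd d), MeasurableSet E →
      volume E ≤ volume (Metric.ball (0 : Rd d) r) / 2 →
      concentration ν q r ≤ (K * J * 2 * ω⁻¹ + K * 2 * 2 ^ d) * ν Eᶜ + T := by
    intro r hr hrR E hEm hE
    have hνE : ν Eᶜ = ∫⁻ y in Eᶜ, g y := by rw [hν, withDensity_apply _ hEm.compl]
    have h1 := concentration_withDensity_le hgm (q := q) (R := R / 2) hr
    rw [← hν] at h1
    refine h1.trans ?_
    gcongr ?_ + _
    rw [add_mul, hνE]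
    refine add_le_add ?_ (setLIntegral_shell_le_of_lowerScaling hd hφm hφ hA hs hr hEm hE)
    set S := (Metric.ball (0 : Rd d) (2 * r) \ Metric.closedBall 0 r) \ E with hS
    have hSm : MeasurableSet S := (measurableSet_ball.diff measurableSet_closedBall).diff hEm
    have hSV := half_volume_ball_le_volume_shell_diff hd hr hE
    rw [← hS, volume_ball_Rd _ hr, ← hω] at hSV
    set I := ∫⁻ z in Metric.ball (0 : Rd d) r, ENNReal.ofReal ((‖z‖ / r) ^ q) * g z
    set D := ENNReal.ofReal (r ^ d)
    have hD0 : D ≠ 0 := by simpa [D] using pow_pos hr d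
    have hDt : D ≠ ∞ := ENNReal.ofReal_ne_top
    -- The near part `I` is bounded by a multiple of `g y` for every `y` in `S`; integrating over
    -- `S`, of volume at least half that of the ball, turns this into a bound by `ν Eᶜ`.
    have h2 : I * volume S ≤ K * (D * J) * ∫⁻ y in Eᶜ, g y := by
      rw [← setLIntegral_const, ← lintegral_const_mul _ hgm]
      refine (setLIntegral_mono' hSm fun y hy => near r hr hrR y ?_ ?_).trans
        (lintegral_mono_set fun y hy => hy.2)
      · simpa using hy.1.2
      · simpa using hy.1.1
    calc I = I * (D * ω / 2) * (2 * ω⁻¹ * D⁻¹) := by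
          calc I = I * ((2⁻¹ * 2) * (ω * ω⁻¹) * (D * D⁻¹)) := by
                rw [ENNReal.inv_mul_cancel two_ne_zero (by finiteness),
                  ENNReal.mul_inv_cancel hω0 hωt, ENNReal.mul_inv_cancel hD0 hDt]
                simp
            _ = _ := by rw [ENNReal.div_eq_inv_mul]; ring
      _ ≤ I * volume S * (2 * ω⁻¹ * D⁻¹) := by gcongr
      _ ≤ (K * (D * J) * ∫⁻ y in Eᶜ, g y) * (2 * ω⁻¹ * D⁻¹) := by gcongr
      _ = (K * J * 2 * ω⁻¹ * ∫⁻ y in Eᶜ, g y) * (D * D⁻¹) := by ring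
      _ = _ := by rw [ENNReal.mul_inv_cancel hD0 hDt, mul_one]
  have hfin : concentration ν q (R / 4) < ∞ := by
    have hr : 0 < R / 4 := by positivity
    set S := (Metric.ball (0 : Rd d) (2 * (R / 4)) \ Metric.closedBall 0 (R / 4)) \ ∅ with hS
    have hSV := half_volume_ball_le_volume_shell_diff hd hr (E := (∅ : Set (Rd d))) (by simp)
    obtain ⟨y, hy⟩ : S.Nonempty := by
      rw [Set.nonempty_iff_ne_empty]
      intro h
      rw [← hS, h, measure_empty] at hSV
      have := Metric.measure_ball_pos volume (0 : Rd d) hr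
      exact absurd hSV (not_le.2 (ENNReal.half_pos this.ne'))
    have h1 := concentration_withDensity_le hgm (q := q) (R := R / 2) hr
    rw [← hν] at h1
    refine h1.trans_lt (ENNReal.add_lt_top.2 ⟨ENNReal.add_lt_top.2 ⟨?_, ?_⟩, hT⟩)
    · refine (near _ hr le_rfl y (by simpa using hy.1.2) (by simpa using hy.1.1)).trans_lt ?_
      exact ENNReal.mul_lt_top (ENNReal.mul_lt_top ENNReal.ofReal_lt_top
        (ENNReal.mul_lt_top ENNReal.ofReal_lt_top hJ)) ENNReal.ofReal_lt_top
    · rw [← withDensity_apply _ (measurableSet_ball.diff measurableSet_ball), ← hν]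
      refine (measure_mono fun z hz => ?_).trans_lt (measure_compl_ball_lt_top hp hνp hr)
      exact hz.2
  -- `T` pays for jumps longer than `R / 2`, and the last term for radii above `R / 4`, where
  -- monotonicity suffices.
  refine ⟨(K * J * 2 * ω⁻¹ + K * 2 * 2 ^ d) + T + concentration ν q (R / 4), ?_,
    fun r hr E hEm hE => ?_⟩
  · have : ω⁻¹ ≠ ∞ := ENNReal.inv_ne_top.2 hω0
    have := hJ.ne
    have := hT.ne
    have := hfin.ne
    have : K ≠ ∞ := ENNReal.ofReal_ne_top
    finiteness
  · rw [mul_add, mul_one]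
    rcases le_total r (R / 4) with h | h
    · refine (small r hr h E hEm hE).trans ?_
      rw [add_comm]
      refine add_le_add (le_add_right le_add_self) ?_
      exact mul_le_mul' (by rw [add_assoc]; exact le_self_add) le_rfl
    · exact (concentration_anti hq (by positivity) h).trans (le_add_right le_add_self)

/-! ### Norms and level sets -/

section Norm

variable {d : ℕ} {ν : Measure (Rd d)} {p : ℝ}

theorem eLpNorm_rpow_eq_lintegral (hp : 0 < p) (f : Rd d → ℝ) :
    eLpNorm f (ENNReal.ofReal p) volume ^ p = ∫⁻ x, ‖f x‖ₑ ^ p := by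
  rw [eLpNorm_eq_lintegral_rpow_enorm_toReal (by simpa using hp) ENNReal.ofReal_ne_top,
    ENNReal.toReal_ofReal hp.le, ← ENNReal.rpow_mul, one_div_mul_cancel hp.ne', ENNReal.rpow_one]

theorem nonlocalSeminorm_rpow (hp : 0 < p) (f : Rd d → ℝ) :
    nonlocalSeminorm ν p f ^ p = ∫⁻ h, (∫⁻ x, ‖f (x + h) - f x‖ₑ ^ p) ∂ν := by
  rw [nonlocalSeminorm, ← ENNReal.rpow_mul, one_div_mul_cancel hp.ne', ENNReal.rpow_one]

theorem lintegral_le_nonlocalNorm_rpow (hp : 0 < p) (f : Rd d → ℝ) :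
    ∫⁻ x, ‖f x‖ₑ ^ p ≤ nonlocalNorm ν p f ^ p := by
  rw [← eLpNorm_rpow_eq_lintegral hp]
  exact ENNReal.rpow_le_rpow le_self_add hp.le

theorem lintegral_lintegral_le_nonlocalNorm_rpow (hp : 0 < p) (f : Rd d → ℝ) :
    ∫⁻ h, (∫⁻ x, ‖f (x + h) - f x‖ₑ ^ p) ∂ν ≤ nonlocalNorm ν p f ^ p := by
  rw [← nonlocalSeminorm_rpow hp]
  exact ENNReal.rpow_le_rpow le_add_self hp.le

/-- Translations preserve null sets. This permits replacing a function by a Borel version, whose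
superlevel sets are measurable. -/
theorem nonlocalNorm_congr_ae {f g : Rd d → ℝ} (h : f =ᵐ[volume] g) :
    nonlocalNorm ν p f = nonlocalNorm ν p g := by
  unfold nonlocalNorm nonlocalSeminorm
  rw [eLpNorm_congr_ae h]
  congr 3
  funext k
  refine lintegral_congr_ae ?_
  have hk := (measurePreserving_add_right volume k).quasiMeasurePreserving.ae_eq h
  filter_upwards [h, hk] with x hx hx'
  simp only [Function.comp_apply] at hx'
  rw [hx, hx']

/-- A jump from `{g ≥ t}` into `{g < u}` changes `g` by at least `t - u`; only such jumps are kept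
after Tonelli. -/
theorem setLIntegral_measure_le_of_levels [SFinite ν] (hp : 0 ≤ p) {g : Rd d → ℝ}
    (hg : Measurable g) (u t : ℝ) :
    ENNReal.ofReal (t - u) ^ p * ∫⁻ x in {x | t ≤ g x}, ν {h | u ≤ g (x + h)}ᶜ ≤
      ∫⁻ h, (∫⁻ x, ‖g (x + h) - g x‖ₑ ^ p) ∂ν := by
  have hm : Measurable (Function.uncurry fun h x : Rd d => ‖g (x + h) - g x‖ₑ ^ p) := by
    unfold Function.uncurry
    fun_prop
  rw [lintegral_lintegral_swap hm.aemeasurable, ← lintegral_const_mul' _ _ (by finiteness)]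
  refine le_trans ?_ (setLIntegral_le_lintegral {x | t ≤ g x} _)
  refine setLIntegral_mono' (measurableSet_le measurable_const hg) fun x hx => ?_
  have hS : MeasurableSet {h | u ≤ g (x + h)}ᶜ :=
    (measurableSet_le measurable_const (by fun_prop)).compl
  rw [← setLIntegral_const]
  refine le_trans ?_ (setLIntegral_le_lintegral {h | u ≤ g (x + h)}ᶜ _)
  refine setLIntegral_mono' hS fun h hh => ?_
  have hh' : g (x + h) < u := by simpa using hh
  have hx' : t ≤ g x := hx
  refine ENNReal.rpow_le_rpow ?_ hp
  rw [Real.enorm_eq_ofReal_abs, abs_sub_comm]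
  exact ENNReal.ofReal_le_ofReal ((by linarith : t - u ≤ g x - g (x + h)).trans (le_abs_self _))

theorem ofReal_rpow_mul_measure_le (hp : 0 ≤ p) {g : Rd d → ℝ} (hg : Measurable g) (t : ℝ) :
    ENNReal.ofReal t ^ p * volume {x | t ≤ g x} ≤ ∫⁻ x, ‖g x‖ₑ ^ p := by
  have hm : Measurable fun x => ‖g x‖ₑ ^ p := by fun_prop
  refine le_trans ?_ (mul_meas_ge_le_lintegral hm (ENNReal.ofReal t ^ p))
  gcongr _ * volume ?_
  intro x hx
  refine ENNReal.rpow_le_rpow ?_ hp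
  rw [Real.enorm_eq_ofReal_abs]
  exact ENNReal.ofReal_le_ofReal (le_trans hx (le_abs_self _))

end Norm

/-! ### Lower bound by a stopping argument on levels -/

/-- A sequence with `τ ^ k * a k ≤ N`, where `1 < τ * b`, cannot stay above `b ^ k * W` forever, so
there is a last index before it first falls below. -/
theorem exists_pow_le_and_lt_pow_succ {a : ℕ → ℝ≥0∞} {τ b W N : ℝ≥0∞} (hτb : 1 < τ * b)
    (hW : W ≠ 0) (hN : N ≠ ∞) (h0 : W ≤ a 0) (ha : ∀ k, τ ^ k * a k ≤ N) :
    ∃ k, b ^ k * W ≤ a k ∧ a (k + 1) < b ^ (k + 1) * W := by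
  by_contra! hcon
  have hall : ∀ k, b ^ k * W ≤ a k := fun k => by
    induction k with
    | zero => simpa using h0
    | succ k ih => exact hcon k ih
  have hbd : ∀ k, (τ * b) ^ k ≤ N / W := fun k => by
    rw [ENNReal.le_div_iff_mul_le (Or.inl hW) (Or.inr hN), mul_pow, mul_assoc]
    exact (mul_le_mul_right (hall k) _).trans (ha k)
  have ht : Filter.Tendsto (fun k => (τ * b) ^ k) Filter.atTop (nhds ∞) :=
    ENNReal.tendsto_pow_atTop_nhds_top_iff.2 hτb
  exact absurd (le_of_tendsto' ht hbd) (not_le.2 (ENNReal.div_lt_top hN hW))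

theorem exists_volume_ball_mul_le_nonlocalNorm_rpow {d : ℕ} (hd : 1 ≤ d) {p q : ℝ} (hp : 0 < p)
    (hq : 0 < q) (hq1 : q < 1) {ν : Measure (Rd d)} [SFinite ν] {C : ℝ≥0∞} (hC : C ≠ ∞)
    (iso : ∀ r : ℝ, 0 < r → ∀ E : Set (Rd d), MeasurableSet E →
      volume E ≤ volume (Metric.ball (0 : Rd d) r) / 2 → concentration ν q r ≤ C * (1 + ν Eᶜ)) :
    ∃ C' : ℝ≥0∞, C' ≠ ∞ ∧ ∀ (x : Rd d) (r : ℝ), 0 < r → ∀ f ∈ nonlocalSobolev ν p,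
      Metric.ball x r ⊆ interior {x | 1 ≤ f x} →
      volume (Metric.ball x r) * (1 + concentration ν q r) ≤ C' * nonlocalNorm ν p f ^ p := by
  have hqd : q < d := hq1.trans_le (by exact_mod_cast hd)
  -- Chosen so that `s ^ p * 2 ^ d = 2 ^ q`: this exceeds 1, which forces the stopping, and matches
  -- the growth of `h_q` under doubling of the radius. `q < d` gives `s < 1`.
  set s : ℝ := 2 ^ (-(d - q) / p) with hsdef
  have hs0 : 0 < s := by positivity
  have hs1 : s < 1 := Real.rpow_lt_one_of_one_lt_of_neg one_lt_two
    (div_neg_of_neg_of_pos (by linarith) hp)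
  set κ := ENNReal.ofReal (2 ^ q) with hκ
  set τ := ENNReal.ofReal s ^ p with hτ
  set δ := ENNReal.ofReal (1 - s) ^ p with hδ
  have hκ1 : 1 < κ := by
    rw [hκ, ← ENNReal.ofReal_one]
    exact (ENNReal.ofReal_lt_ofReal_iff (by positivity)).2 (Real.one_lt_rpow one_lt_two hq)
  have hτκ : τ * 2 ^ d = κ := by
    have h2 : (2 : ℝ≥0∞) ^ d = ENNReal.ofReal (2 ^ d) := by
      rw [ENNReal.ofReal_pow zero_le_two, ENNReal.ofReal_ofNat]
    rw [hτ, hκ, h2, ENNReal.ofReal_rpow_of_pos hs0, ← ENNReal.ofReal_mul (by positivity), hsdef,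
      ← Real.rpow_mul zero_le_two, div_mul_cancel₀ _ hp.ne', ← Real.rpow_natCast,
      ← Real.rpow_add two_pos]
    congr 2
    ring
  have hδ0 : δ ≠ 0 := by
    simp only [hδ, ne_eq, ENNReal.rpow_eq_zero_iff, ENNReal.ofReal_eq_zero, not_or, not_and]
    exact ⟨fun h => absurd h (by linarith), fun h => absurd h ENNReal.ofReal_ne_top⟩
  have hδt : δ ≠ ∞ := by finiteness
  have hτk : ∀ k : ℕ, ENNReal.ofReal (s ^ k) ^ p = τ ^ k := fun k => by
    rw [ENNReal.ofReal_pow hs0.le, hτ, ← ENNReal.rpow_natCast, ← ENNReal.rpow_natCast,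
      ← ENNReal.rpow_mul, ← ENNReal.rpow_mul, mul_comm]
  refine ⟨1 + κ ^ 2 * C * (1 + δ⁻¹), ?_, fun x r hr f hf hball => ?_⟩
  · have : δ⁻¹ ≠ ∞ := ENNReal.inv_ne_top.2 hδ0
    have : κ ≠ ∞ := ENNReal.ofReal_ne_top
    finiteness
  obtain ⟨hfm, hfN⟩ := hf
  set g := hfm.mk f
  have hg : Measurable g := hfm.measurable_mk
  have hfg : f =ᵐ[volume] g := hfm.ae_eq_mk
  set N := nonlocalNorm ν p f ^ p with hN
  have hNg : N = nonlocalNorm ν p g ^ p := by rw [hN, nonlocalNorm_congr_ae hfg]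
  have hNt : N ≠ ∞ := ENNReal.rpow_ne_top_of_nonneg hp.le hfN.ne
  set W := volume (Metric.ball x r) with hW
  have hW0 : W ≠ 0 := (Metric.measure_ball_pos _ _ hr).ne'
  set a : ℕ → ℝ≥0∞ := fun k => volume {y | s ^ k ≤ g y} with ha
  have ha0 : W ≤ a 0 := by
    refine measure_mono_ae ?_
    filter_upwards [hfg] with y hy hyb
    have h1 : y ∈ {x | 1 ≤ f x} := interior_subset (hball hyb)
    change s ^ 0 ≤ g y
    rw [pow_zero, ← hy]
    exact h1
  have haN : ∀ k, τ ^ k * a k ≤ N := fun k => by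
    rw [← hτk, hNg]
    exact (ofReal_rpow_mul_measure_le hp.le hg _).trans (lintegral_le_nonlocalNorm_rpow hp g)
  obtain ⟨k, hk1, hk2⟩ := exists_pow_le_and_lt_pow_succ (by rwa [hτκ]) hW0 hNt ha0 haN
  have hWN : W ≤ N := by simpa using (ha0.trans (by simpa using haN 0))
  -- One doubling beyond `k + 1` makes the level set at most half of the ball of radius `ρ`, as `2 ^
  -- d ≥ 2`.
  set ρ : ℝ := 2 ^ (k + 2) * r with hρ
  have hρ0 : 0 < ρ := by positivity
  have hrρ : r ≤ ρ := le_mul_of_one_le_left hr.le (one_le_pow₀ one_le_two)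
  have hvol : (2 ^ d) ^ (k + 1) * W ≤ volume (Metric.ball (0 : Rd d) ρ) / 2 := by
    have e : volume (Metric.ball (0 : Rd d) ρ) = (2 ^ d) ^ (k + 2) * W := by
      rw [hW, volume_ball_Rd _ hr, volume_ball_Rd _ hρ0, hρ, mul_pow,
        ENNReal.ofReal_mul (by positivity), ENNReal.ofReal_pow (by positivity),
        ENNReal.ofReal_pow zero_le_two, ENNReal.ofReal_ofNat, ← pow_mul, ← pow_mul,
        mul_comm d, mul_assoc]
    rw [e, ENNReal.le_div_iff_mul_le (Or.inl two_ne_zero) (Or.inl (by finiteness)),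
      pow_succ _ (k + 1), mul_right_comm]
    gcongr
    calc (2 : ℝ≥0∞) = 2 ^ 1 := (pow_one _).symm
      _ ≤ 2 ^ d := pow_le_pow_right₀ one_le_two hd
  have hH : concentration ν q r ≤ κ ^ (k + 2) * concentration ν q ρ := by
    have h := concentration_le_mul (ν := ν) hq hr hrρ
    have e : ρ / r = 2 ^ (k + 2) := by rw [hρ, mul_div_cancel_right₀ _ hr.ne']
    rwa [e, ← Real.rpow_pow_comm zero_le_two, ENNReal.ofReal_pow (by positivity)] at h
  set F : Rd d → ℝ≥0∞ := fun y => ν {h | s ^ (k + 1) ≤ g (y + h)}ᶜ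
  have hiso : ∀ y, concentration ν q ρ ≤ C * (1 + F y) := fun y => by
    refine iso ρ hρ0 _ (measurableSet_le measurable_const (by fun_prop)) ?_
    have e : volume {h | s ^ (k + 1) ≤ g (y + h)} = a (k + 1) :=
      measure_preimage_add volume y {y | s ^ (k + 1) ≤ g y}
    rw [e]
    exact hk2.le.trans hvol
  have hint : concentration ν q ρ * a k ≤ C * (a k + ∫⁻ y in {y | s ^ k ≤ g y}, F y) := by
    rw [ha, ← setLIntegral_const]
    refine (lintegral_mono fun y => hiso y).trans ?_
    rw [lintegral_const_mul' _ _ hC, lintegral_add_left measurable_const, setLIntegral_const,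
      one_mul]
  have hF : τ ^ k * ∫⁻ y in {y | s ^ k ≤ g y}, F y ≤ δ⁻¹ * N := by
    have h := (setLIntegral_measure_le_of_levels (ν := ν) hp.le hg (s ^ (k + 1)) (s ^ k)).trans
      (lintegral_lintegral_le_nonlocalNorm_rpow hp g)
    have e : s ^ k - s ^ (k + 1) = s ^ k * (1 - s) := by ring
    rw [← hNg, e, ENNReal.ofReal_mul (by positivity), ENNReal.mul_rpow_of_nonneg _ _ hp.le, hτk,
      mul_comm (τ ^ k), mul_assoc] at h
    calc _ = δ⁻¹ * (δ * (τ ^ k * ∫⁻ y in {y | s ^ k ≤ g y}, F y)) := by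
          rw [← mul_assoc, ENNReal.inv_mul_cancel hδ0 hδt, one_mul]
      _ ≤ _ := by gcongr
  have hmain : W * concentration ν q r ≤ κ ^ 2 * C * (1 + δ⁻¹) * N := by
    calc W * concentration ν q r ≤ W * (κ ^ (k + 2) * concentration ν q ρ) := by gcongr
      -- The loss `κ ^ k` is exactly `τ ^ k * (2 ^ d) ^ k`, the Chebyshev weight times the volume
      -- growth.
      _ = κ ^ 2 * (τ ^ k * (((2 ^ d) ^ k * W) * concentration ν q ρ)) := by
          rw [pow_add, ← hτκ]; ring
      _ ≤ κ ^ 2 * (τ ^ k * (a k * concentration ν q ρ)) := by gcongr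
      _ ≤ κ ^ 2 * (τ ^ k * (C * (a k + ∫⁻ y in {y | s ^ k ≤ g y}, F y))) := by
          rw [mul_comm (a k)]; gcongr
      _ = κ ^ 2 * C * (τ ^ k * a k + τ ^ k * ∫⁻ y in {y | s ^ k ≤ g y}, F y) := by ring
      _ ≤ κ ^ 2 * C * (N + δ⁻¹ * N) := by gcongr; exact haN k
      _ = _ := by ring
  rw [mul_add, mul_one, add_mul, one_mul]
  exact add_le_add hWN hmain

/-! ### Upper bound by a cutoff function -/

theorem nonlocalCap_ball_le {d : ℕ} {ν : Measure (Rd d)} {p : ℝ} (hp : 1 ≤ p) (x : Rd d) {r : ℝ}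
    (hr : 0 < r) :
    nonlocalCap ν p (Metric.ball x r) ≤
      2 ^ p * volume (Metric.ball x (2 * r)) * (1 + concentration ν p r) := by
  have hp0 : 0 < p := one_pos.trans_le hp
  set B := Metric.ball x (2 * r)
  have hBm : MeasurableSet B := measurableSet_ball
  set V := volume B
  have hV0 : V ≠ 0 := (Metric.measure_ball_pos _ _ (by positivity)).ne'
  set f : Rd d → ℝ := fun y => min 1 (max 0 (2 - ‖y - x‖ / r)) with hf
  have hfc : Continuous f := by fun_prop
  have hf0 : ∀ y, 0 ≤ f y := fun y => le_min zero_le_one (le_max_left _ _)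
  have hf1 : ∀ y, f y ≤ 1 := fun y => min_le_left _ _
  have hfB : ∀ y ∉ B, f y = 0 := fun y hy => by
    have h : 2 * r ≤ ‖y - x‖ := by simpa [B, dist_eq_norm] using hy
    have h' : 2 - ‖y - x‖ / r ≤ 0 := by
      rw [sub_nonpos, le_div_iff₀ hr]
      exact h
    simp [hf, max_eq_left h']
  have hlip : ∀ y h, |f (y + h) - f y| ≤ ‖h‖ / r := fun y h => by
    have h1 : |f (y + h) - f y| ≤ |max 0 (2 - ‖y + h - x‖ / r) - max 0 (2 - ‖y - x‖ / r)| := by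
      have := abs_min_sub_min_le_max 1 (max 0 (2 - ‖y + h - x‖ / r)) 1 (max 0 (2 - ‖y - x‖ / r))
      simpa using this
    have h2 : |max 0 (2 - ‖y + h - x‖ / r) - max 0 (2 - ‖y - x‖ / r)| ≤
        |(2 - ‖y + h - x‖ / r) - (2 - ‖y - x‖ / r)| := by
      have := abs_max_sub_max_le_max 0 (2 - ‖y + h - x‖ / r) 0 (2 - ‖y - x‖ / r)
      simpa using this
    have e : (2 - ‖y + h - x‖ / r) - (2 - ‖y - x‖ / r) = (‖y - x‖ - ‖y + h - x‖) / r := by ring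
    refine (h1.trans h2).trans ?_
    rw [e, abs_div, abs_of_pos hr]
    gcongr
    refine (abs_norm_sub_norm_le _ _).trans (le_of_eq ?_)
    rw [← norm_neg]
    congr 1
    abel
  have hLp : ∫⁻ y, ‖f y‖ₑ ^ p ≤ V := by
    rw [← one_mul V, ← lintegral_indicator_const hBm]
    refine lintegral_mono fun y => ?_
    by_cases hy : y ∈ B
    · rw [Set.indicator_of_mem hy]
      refine ENNReal.rpow_le_one ?_ hp0.le
      rw [Real.enorm_eq_ofReal (hf0 y)]
      simpa using hf1 y
    · rw [hfB y hy]
      simp [hp0]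
  have hinner : ∀ h, ∫⁻ y, ‖f (y + h) - f y‖ₑ ^ p ≤
      2 * V * ENNReal.ofReal (min 1 (‖h‖ ^ p / r ^ p)) := fun h => by
    set m := ENNReal.ofReal (min 1 (‖h‖ ^ p / r ^ p))
    have hle : ∀ y, ‖f (y + h) - f y‖ₑ ^ p ≤ m := fun y => by
      rw [Real.enorm_eq_ofReal_abs, ENNReal.ofReal_rpow_of_nonneg (abs_nonneg _) hp0.le]
      refine ENNReal.ofReal_le_ofReal (le_min ?_ ?_)
      · refine Real.rpow_le_one (abs_nonneg _) ?_ hp0.le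
        rw [abs_le]
        constructor <;> linarith [hf0 y, hf1 y, hf0 (y + h), hf1 (y + h)]
      · rw [← Real.div_rpow (norm_nonneg h) hr.le]
        exact Real.rpow_le_rpow (abs_nonneg _) (hlip y h) hp0.le
    -- The difference vanishes unless `y` or `y + h` lies in `B`, hence the factor 2 in front of
    -- `V`.
    have hpt : ∀ y, ‖f (y + h) - f y‖ₑ ^ p ≤
        B.indicator (fun _ => m) y + B.indicator (fun _ => m) (y + h) := fun y => by
      by_cases hy : y ∈ B
      · rw [Set.indicator_of_mem hy]
        exact le_add_right (hle y)
      by_cases hy' : y + h ∈ B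
      · rw [Set.indicator_of_mem hy']
        exact le_add_left (hle y)
      · simp [hfB y hy, hfB _ hy', hp0]
    refine (lintegral_mono hpt).trans (le_of_eq ?_)
    rw [lintegral_add_left (measurable_const.indicator hBm),
      lintegral_add_right_eq_self (fun y => B.indicator (fun _ => m) y) h,
      lintegral_indicator_const hBm]
    ring
  have hsemi : ∫⁻ h, (∫⁻ y, ‖f (y + h) - f y‖ₑ ^ p) ∂ν ≤ 2 * V * concentration ν p r := by
    rw [concentration, ← lintegral_const_mul' _ _ (by finiteness)]
    exact lintegral_mono hinner
  have hnorm : nonlocalNorm ν p f ^ p ≤ 2 ^ p * V * (1 + concentration ν p r) := by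
    refine (ENNReal.rpow_add_le_mul_rpow_add_rpow _ _ hp).trans ?_
    rw [eLpNorm_rpow_eq_lintegral hp0, nonlocalSeminorm_rpow hp0]
    have e : (2 : ℝ≥0∞) ^ p = 2 ^ (p - 1) * 2 := by
      nth_rewrite 3 [← ENNReal.rpow_one 2]
      rw [← ENNReal.rpow_add _ _ two_ne_zero (by finiteness), sub_add_cancel]
    rw [e, mul_assoc, mul_assoc]
    gcongr
    calc _ ≤ V + 2 * V * concentration ν p r := add_le_add hLp hsemi
      _ ≤ 2 * V + 2 * V * concentration ν p r := by
          gcongr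
          exact le_mul_of_one_le_left' one_le_two
      _ = _ := by ring
  -- If the bound is infinite the cutoff may fail to be admissible, but there is nothing to prove.
  rcases eq_or_ne (2 ^ p * V * (1 + concentration ν p r)) ∞ with htop | htop
  · rw [htop]; exact le_top
  refine le_trans (sInf_le ?_) hnorm
  refine ⟨f, ⟨hfc.aestronglyMeasurable, ?_⟩, ?_, rfl⟩
  · by_contra hcon
    rw [not_lt, top_le_iff] at hcon
    rw [hcon, ENNReal.top_rpow_of_pos hp0, top_le_iff] at hnorm
    exact htop hnorm
  · refine interior_maximal (fun y hy => ?_) Metric.isOpen_ball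
    have h : ‖y - x‖ < r := by simpa [dist_eq_norm] using hy
    have : 1 ≤ 2 - ‖y - x‖ / r := by linarith [(div_lt_one hr).2 h]
    exact le_min (le_refl (1 : ℝ)) (le_max_of_le_right this)

/-! ### Conclusion -/

theorem theorem21 (d : ℕ) (hd : 1 ≤ d) (p : ℝ) (hp : 1 ≤ p)
    (φ : ℝ → ℝ) (hφ_meas : Measurable φ) (hφ_nonneg : ∀ r : ℝ, 0 < r → 0 ≤ φ r)
    (ν : Measure (Rd d))
    (hν : ν = (volume : Measure (Rd d)).withDensity (fun y => ENNReal.ofReal (φ ‖y‖)))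
    (hν_int : ∫⁻ y, ENNReal.ofReal (min 1 (‖y‖ ^ p)) ∂ν < ∞)
    (hindex : ((-(d : ℝ) - 1 : ℝ) : EReal) < lowerMatuszewskaIndexAtZero φ) :
    ∃ c C : ℝ, 0 < c ∧ 0 < C ∧ ∀ (x : Rd d) (r : ℝ), 0 < r →
      ENNReal.ofReal (c * r ^ d) * (1 + concentration ν p r)
          ≤ nonlocalCap ν p (Metric.ball x r) ∧
      nonlocalCap ν p (Metric.ball x r)
          ≤ ENNReal.ofReal (C * r ^ d) * (1 + concentration ν p r) := by
  have hp0 : 0 < p := one_pos.trans_le hp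
  obtain ⟨a, A, R, ha, hA, hR, hs⟩ := exists_lowerScaling hφ_nonneg hindex
  -- This is where the threshold `-d - 1` enters: it leaves room for `q < 1` with `q + a > -d`, and
  -- `q < 1` serves both `q ≤ p` and `q < d`.
  obtain ⟨q, hq, hq1⟩ := exists_between (max_lt one_pos (show -(d : ℝ) - a < 1 by linarith))
  obtain ⟨hq0, hqa⟩ := max_lt_iff.1 hq
  obtain ⟨C₀, hC₀, iso⟩ := exists_concentration_le_mul_one_add_measure_compl hd hφ_meas hφ_nonneg
    hA hR hs hp0 hq0 (by linarith) hν hν_int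
  have : SFinite ν := by rw [hν]; infer_instance
  obtain ⟨C₁, hC₁, hlow⟩ := exists_volume_ball_mul_le_nonlocalNorm_rpow hd hp0 hq0 hq1 hC₀ iso
  set ω := volume (Metric.ball (0 : Rd d) 1) with hω
  have hω0 : ω ≠ 0 := (Metric.measure_ball_pos _ _ one_pos).ne'
  have hωt : ω ≠ ∞ := measure_ball_lt_top.ne
  -- Adding 1 to `C₁` avoids dividing by zero.
  have hc0 : ω / (C₁ + 1) ≠ 0 := ENNReal.div_ne_zero.2 ⟨hω0, by finiteness⟩
  have hct : ω / (C₁ + 1) ≠ ∞ := (ENNReal.div_lt_top hωt (by simp)).ne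
  have hC0 : 2 ^ p * 2 ^ d * ω ≠ 0 := by
    refine mul_ne_zero (mul_ne_zero ?_ (by positivity)) hω0
    exact (ENNReal.rpow_pos two_pos (by finiteness)).ne'
  have hCt : 2 ^ p * 2 ^ d * ω ≠ ∞ := by finiteness
  refine ⟨(ω / (C₁ + 1)).toReal, (2 ^ p * 2 ^ d * ω).toReal, ENNReal.toReal_pos hc0 hct,
    ENNReal.toReal_pos hC0 hCt, fun x r hr => ⟨?_, ?_⟩⟩
  · refine le_sInf ?_
    rintro _ ⟨f, hf, hball, rfl⟩
    have h := hlow x r hr f hf hball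
    rw [ENNReal.ofReal_mul ENNReal.toReal_nonneg, ENNReal.ofReal_toReal hct]
    rw [volume_ball_Rd x hr, ← hω] at h
    have hle : ENNReal.ofReal (r ^ d) * ω * (1 + concentration ν p r) ≤
        (C₁ + 1) * nonlocalNorm ν p f ^ p := by
      refine le_trans ?_ (h.trans (by gcongr; exact le_self_add))
      gcongr
      exact concentration_anti_exponent (hq1.le.trans hp) hq0 hr
    calc _ = (C₁ + 1)⁻¹ * (ENNReal.ofReal (r ^ d) * ω * (1 + concentration ν p r)) := by
          rw [ENNReal.div_eq_inv_mul]; ring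
      _ ≤ (C₁ + 1)⁻¹ * ((C₁ + 1) * nonlocalNorm ν p f ^ p) := by gcongr
      _ = _ := by
          rw [← mul_assoc, ENNReal.inv_mul_cancel (by simp) (by finiteness), one_mul]
  · refine (nonlocalCap_ball_le hp x hr).trans (le_of_eq ?_)
    rw [ENNReal.ofReal_mul ENNReal.toReal_nonneg, ENNReal.ofReal_toReal hCt,
      volume_ball_two_mul x hr, volume_ball_Rd x hr]
    ring
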